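/- **Theorem (concentration with fixed admittances and uncertain contingencies).** Consider a network with $n$ nodes and $m$ lines, where line $l$ joins two distinct nodes $i_l\neq j_l$ (parallel lines are allowed), and let $a_l=e_{i_l}-e_{j_l}\in\mathbb R^n$ be its incidence vector. Let each line have a fixed admittance $y_l\in\mathbb C$ with $|y_l|\le 1$ and a closing probability $p_l\in[0,1]$. Let $\xi_1,\dots,\xi_m$ be independent random variables with $\xi_l\sim\mathrm{Bernoulli}(p_l)$, and put $$Y=\sum_{l=1}^m \xi_l\,y_l\,a_la_l^{\top}\in\mathbb C^{n\times n},\qquad \tilde Y=Y-\mathbb E Y .$$ Define the contingency factors $c_l=2p_l(1-p_l)|y_l|^2$, the degree of criticality $d_i(c)=\sum_{l\ni i}c_l$ of node $i$ (the sum over the lines that have $i$ as an endpoint), the maximum criticality $\Delta_c=\max_{1\le i\le n} d_i(c)$, and the normalized total criticality $\bar D=\Delta_c^{-1}\sum_{i=1}^n d_i(c)$, with $\bar D=0$ if $\Delta_c=0$ (in which case $\tilde Y=0$ almost surely). Let $\|\cdot\|$ be the operator norm of a matrix on $\mathbb C^n$ with the Euclidean norm. Then, for all real $t\ge\sqrt{2\Delta_c}+\tfrac23$,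 $$\mathbb P\big(\|\tilde Y\|\ge t\big)\le 8\,\bar D\,\exp\!\left(\frac{-t^2}{4(\Delta_c+t/3)}\right).$$ Moreover, there is a universal constant $C>0$ (independent of the network, the admittances, the probabilities and the probability space) such that always $$\mathbb E\|\tilde Y\|\le C\left(\sqrt{2\Delta_c\log(1+2\bar D)}+2\log(1+2\bar D)\right).$$ -/

import Mathlib

open MeasureTheory ProbabilityTheory
open scoped Matrix.Norms.L2Operator

noncomputable section

/-- A power network with `n` nodes and `m` lines: line `l` joins the two distinct nodes
`src l` and `tgt l`. Parallel lines are allowed; the orientation of a line is immaterial. -/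
structure PowerNetwork (n m : ℕ) where
  src : Fin m → Fin n
  tgt : Fin m → Fin n
  src_ne_tgt : ∀ l, src l ≠ tgt l

namespace PowerNetwork

variable {n m : ℕ}

/-- Node `i` is an endpoint of line `l`. -/
def Incident (N : PowerNetwork n m) (i : Fin n) (l : Fin m) : Prop :=
  N.src l = i ∨ N.tgt l = i

instance (N : PowerNetwork n m) (i : Fin n) (l : Fin m) : Decidable (N.Incident i l) :=
  inferInstanceAs (Decidable (N.src l = i ∨ N.tgt l = i))

/-- The incidence vector `a_l = e_i - e_j` of the line `l = (i, j)`. -/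
def incidenceVec (N : PowerNetwork n m) (l : Fin m) : Fin n → ℂ :=
  Pi.single (N.src l) 1 - Pi.single (N.tgt l) 1

/-- The admittance matrix `∑ l, w_l a_l a_lᵀ` with line weights `w`. -/
def admittanceMatrix (N : PowerNetwork n m) (w : Fin m → ℂ) : Matrix (Fin n) (Fin n) ℂ :=
  ∑ l, w l • Matrix.vecMulVec (N.incidenceVec l) (N.incidenceVec l)

/-- The contingency factor `c_l = 2 p_l (1 - p_l) |y_l|²` of line `l`. -/
def contingencyFactor (y : Fin m → ℂ) (p : Fin m → unitInterval) (l : Fin m) : ℝ :=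
  2 * (p l : ℝ) * (1 - (p l : ℝ)) * ‖y l‖ ^ 2

/-- The degree of criticality of node `i`: the sum of `c_l` over the lines `l` at `i`. -/
def criticality (N : PowerNetwork n m) (y : Fin m → ℂ) (p : Fin m → unitInterval) (i : Fin n) :
    ℝ :=
  ∑ l with N.Incident i l, contingencyFactor y p l

/-- The maximum criticality over all nodes. -/
def maxCriticality (N : PowerNetwork n m) (y : Fin m → ℂ) (p : Fin m → unitInterval) : ℝ :=
  ⨆ i, N.criticality y p i

/-- The total criticality divided by the maximum criticality; it is `0` if the maximum is `0`. -/
def normalizedCriticality (N : PowerNetwork n m) (y : Fin m → ℂ) (p : Fin m → unitInterval) : ℝ :=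
  (N.maxCriticality y p)⁻¹ * ∑ i, N.criticality y p i

variable {Ω : Type*}

/-- The random admittance matrix `Y = ∑ l, ξ_l y_l a_l a_lᵀ`. -/
def randomAdmittance (N : PowerNetwork n m) (y : Fin m → ℂ) (ξ : Fin m → Ω → ℝ) (ω : Ω) :
    Matrix (Fin n) (Fin n) ℂ :=
  N.admittanceMatrix fun l => (ξ l ω : ℂ) * y l

/-- The centred matrix `Y - E Y`; the expectation of a random matrix is taken entrywise. -/
def centredAdmittance [MeasurableSpace Ω] (μ : Measure Ω) (N : PowerNetwork n m)
    (y : Fin m → ℂ) (ξ : Fin m → Ω → ℝ) (ω : Ω) : Matrix (Fin n) (Fin n) ℂ :=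
  N.randomAdmittance y ξ ω - Matrix.of fun i j => ∫ ω', N.randomAdmittance y ξ ω' i j ∂μ

end PowerNetwork

end

/-!
The matrix `Y - E Y` is a sum of independent centred matrices `(ξ_l - p_l) y_l a_l a_lᵀ`, and the
bounds are those of the matrix Bernstein inequality with intrinsic dimension for its Hermitian
dilation. Each dilated summand is `(ξ_l - p_l) M_l` with a fixed Hermitian matrix `M_l` of norm at
most `2`, and `∑ l, p_l (1 - p_l) M_l²` consists of two diagonal blocks equal to the Laplacian `L`
with line weights `c_l`. Twice the diagonal matrix of the degrees of criticality dominates `L`, so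
`L ≤ 2 Δ_c`, while `tr L = ∑ i, d_i(c)`; this produces `Δ_c` and the normalized total criticality.

The trace moment generating function is usually bounded through Lieb's concavity theorem. Here the
random part of each summand is scalar, and the Golden–Thompson inequality
(`Matrix.re_trace_exp_add_le`) suffices: with `X = θ (ξ - p) M` and `Λ = κ p (1 - p) M²`,
`E tr exp (H + X) ≤ tr (exp (H + Λ) E exp (X - Λ)) ≤ tr exp (H + Λ)`,
because `X` and `Λ` are functions of the one matrix `M`, so that `E exp (X - Λ) ≤ 1` is a statement
about a real Bernoulli variable (`Matrix.bernoulli_trace_exp_le`). Independence lets the summands be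
replaced one after another (`integral_trace_exp_bernoulli_sum_le`). Golden–Thompson itself follows
from the Lie–Trotter formula and the trace inequality `|tr (P Q)^N| ≤ |tr (P^N Q^N)|` for Hermitian
`P`, `Q` and `N` a power of two.

As `exp` is convex, `tr (exp (κ V) - 1) ≤ (tr V / v) (exp (κ v) - 1)` for `0 ≤ V ≤ v`, whence
`E (cosh (θ ‖Y - E Y‖) - 1) ≤ D (exp (κ v) - 1)` with `D` the normalized total criticality and
`v = 2 Δ_c` (`PowerNetwork.integral_cosh_norm_centredAdmittance_le`). Markov's inequality gives the
tail bound, and the inequality `log x ≤ x - 1` gives the bound on the mean.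
-/

/-! ### The Golden–Thompson inequality -/

namespace Matrix

variable {k : Type*} [Fintype k] [DecidableEq k]

lemma trace_mul_pow_comm (A B : Matrix k k ℂ) (n : ℕ) :
    ((A * B) ^ n).trace = ((B * A) ^ n).trace := by
  cases n with
  | zero => simp
  | succ n =>
    have h : ∀ j : ℕ, (A * B) ^ j * A = A * (B * A) ^ j := by
      intro j
      induction j with
      | zero => simp
      | succ j ih => rw [pow_succ', mul_assoc, ih, pow_succ']; simp only [mul_assoc]
    rw [pow_succ, ← mul_assoc, h, mul_assoc, trace_mul_comm, pow_succ, mul_assoc]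

/-- The trace of a product is controlled by Hilbert–Schmidt norms. -/
lemma norm_trace_mul_le {k : Type*} [Fintype k] (U V : Matrix k k ℂ) :
    ‖(U * V).trace‖ ≤ ((U * Uᴴ).trace.re + (V * Vᴴ).trace.re) / 2 := by
  have hs : ∀ W : Matrix k k ℂ, (W * Wᴴ).trace.re = ∑ i, ∑ j, ‖W i j‖ ^ 2 := by
    intro W
    simp only [trace, diag, mul_apply, conjTranspose_apply, Complex.re_sum]
    refine Finset.sum_congr rfl fun i _ => Finset.sum_congr rfl fun j _ => ?_
    rw [Complex.star_def, Complex.mul_conj, Complex.ofReal_re, Complex.normSq_eq_norm_sq]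
  rw [hs U, hs V, Finset.sum_comm (f := fun i j => ‖V i j‖ ^ 2), ← Finset.sum_add_distrib,
    Finset.sum_div]
  simp only [trace, diag, mul_apply]
  refine (norm_sum_le _ _).trans (Finset.sum_le_sum fun i _ => ?_)
  rw [← Finset.sum_add_distrib, Finset.sum_div]
  refine (norm_sum_le _ _).trans (Finset.sum_le_sum fun j _ => ?_)
  rw [norm_mul]
  nlinarith [sq_nonneg (‖U i j‖ - ‖V j i‖)]

/-- Two trace inequalities for powers of two, proved in one induction since each feeds the other.
The second, applied to exponentials, becomes the Golden–Thompson inequality in the limit. -/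
lemma norm_trace_two_pow_le_aux (n : ℕ) :
    (∀ X : Matrix k k ℂ, ‖(X ^ 2 ^ (n + 1)).trace‖ ≤ ((X * Xᴴ) ^ 2 ^ n).trace.re) ∧
    (∀ P Q : Matrix k k ℂ, P.IsHermitian → Q.IsHermitian →
      ‖((P * Q) ^ 2 ^ n).trace‖ ≤ ‖(P ^ 2 ^ n * Q ^ 2 ^ n).trace‖) := by
  induction n with
  | zero =>
    refine ⟨fun X => ?_, fun P Q _ _ => by simp⟩
    have := norm_trace_mul_le X X
    simp only [zero_add, pow_one, pow_zero, sq]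
    linarith
  | succ n ih =>
    obtain ⟨hT, hG⟩ := ih
    constructor
    · intro X
      have hP : (Xᴴ * X).IsHermitian := isHermitian_conjTranspose_mul_self X
      have hQ : (X * Xᴴ).IsHermitian := isHermitian_mul_conjTranspose_self X
      have e1 : X ^ 2 ^ (n + 1 + 1) = (X ^ 2) ^ 2 ^ (n + 1) := by
        rw [← pow_mul, ← pow_succ']
      have e2 : X ^ 2 * (X ^ 2)ᴴ = X * (X * Xᴴ * Xᴴ) := by
        simp only [sq, conjTranspose_mul, mul_assoc]
      have e3 : X * Xᴴ * Xᴴ * X = (X * Xᴴ) * (Xᴴ * X) := by simp only [mul_assoc]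
      have hc : ((Xᴴ * X) ^ 2 ^ (n + 1)).trace = ((X * Xᴴ) ^ 2 ^ (n + 1)).trace :=
        trace_mul_pow_comm _ _ _
      have h2 : ∀ W : Matrix k k ℂ, W.IsHermitian →
          W ^ 2 ^ n * (W ^ 2 ^ n)ᴴ = W ^ 2 ^ (n + 1) := by
        intro W hW
        rw [conjTranspose_pow, hW.eq, ← pow_add, pow_succ, mul_two]
      calc ‖(X ^ 2 ^ (n + 1 + 1)).trace‖ ≤ ((X ^ 2 * (X ^ 2)ᴴ) ^ 2 ^ n).trace.re := e1 ▸ hT _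
        _ = (((X * Xᴴ) * (Xᴴ * X)) ^ 2 ^ n).trace.re := by
          rw [e2, trace_mul_pow_comm, e3]
        _ ≤ ‖(((X * Xᴴ) * (Xᴴ * X)) ^ 2 ^ n).trace‖ := Complex.re_le_norm _
        _ ≤ ‖((X * Xᴴ) ^ 2 ^ n * (Xᴴ * X) ^ 2 ^ n).trace‖ := hG _ _ hQ hP
        _ ≤ _ := norm_trace_mul_le _ _
        _ = ((X * Xᴴ) ^ 2 ^ (n + 1)).trace.re := by
          rw [h2 _ hP, h2 _ hQ, hc]; ring
    · intro P Q hP hQ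
      have e1 : P * Q * (P * Q)ᴴ = P * (Q ^ 2 * P) := by
        simp only [conjTranspose_mul, hP.eq, hQ.eq, sq, mul_assoc]
      have e2 : Q ^ 2 * P * P = Q ^ 2 * P ^ 2 := by simp only [sq, mul_assoc]
      have e3 : ∀ W : Matrix k k ℂ, W ^ 2 ^ (n + 1) = (W ^ 2) ^ 2 ^ n := by
        intro W; rw [← pow_mul, ← pow_succ']
      calc ‖((P * Q) ^ 2 ^ (n + 1)).trace‖ ≤ ((P * Q * (P * Q)ᴴ) ^ 2 ^ n).trace.re := hT _
        _ = ((P ^ 2 * Q ^ 2) ^ 2 ^ n).trace.re := by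
          rw [e1, trace_mul_pow_comm, e2, trace_mul_pow_comm]
        _ ≤ ‖((P ^ 2 * Q ^ 2) ^ 2 ^ n).trace‖ := Complex.re_le_norm _
        _ ≤ ‖((P ^ 2) ^ 2 ^ n * (Q ^ 2) ^ 2 ^ n).trace‖ := hG _ _ (hP.pow 2) (hQ.pow 2)
        _ = _ := by rw [← e3, ← e3]

end Matrix

section LieTrotter

open Filter Topology NormedSpace

variable {𝔸 : Type*} [NormedRing 𝔸]

lemma norm_pow_sub_pow_le_of_norm_le [NormOneClass 𝔸] {x y : 𝔸} {K : ℝ} (hK : 1 ≤ K)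
    (hx : ‖x‖ ≤ K) (hy : ‖y‖ ≤ K) (n : ℕ) : ‖x ^ n - y ^ n‖ ≤ n * ‖x - y‖ * K ^ n := by
  have hK0 : 0 ≤ K := zero_le_one.trans hK
  induction n with
  | zero => simp
  | succ n ih =>
    have e : x ^ (n + 1) - y ^ (n + 1) = x ^ n * (x - y) + (x ^ n - y ^ n) * y := by
      rw [pow_succ, pow_succ]; noncomm_ring
    have h1 : ‖x ^ n * (x - y)‖ ≤ K ^ n * ‖x - y‖ :=
      (norm_mul_le _ _).trans (mul_le_mul_of_nonneg_right
        ((norm_pow_le x n).trans (pow_le_pow_left₀ (norm_nonneg _) hx n)) (norm_nonneg _))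
    have h2 : ‖(x ^ n - y ^ n) * y‖ ≤ n * ‖x - y‖ * K ^ n * K :=
      (norm_mul_le _ _).trans (mul_le_mul ih hy (norm_nonneg _) (by positivity))
    have h3 : K ^ n * ‖x - y‖ ≤ ‖x - y‖ * K ^ (n + 1) := by
      rw [mul_comm, pow_succ]
      exact mul_le_mul_of_nonneg_left (le_mul_of_one_le_right (by positivity) hK) (norm_nonneg _)
    rw [e]
    refine (norm_add_le _ _).trans ((add_le_add h1 h2).trans ?_)
    rw [pow_succ] at h3 ⊢
    push_cast
    nlinarith

/-- If two curves pass through `1` with the same velocity `D` at time `0`, then their `n`-th powers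
at time `1 / n` have the same limit behaviour. -/
lemma tendsto_pow_sub_pow_of_hasDerivAt [NormOneClass 𝔸] [NormedAlgebra ℝ 𝔸] {F G : ℝ → 𝔸} {D : 𝔸}
    (hF : HasDerivAt F D 0) (hG : HasDerivAt G D 0) (hF0 : F 0 = 1) (hG0 : G 0 = 1) :
    Tendsto (fun n : ℕ => F (n : ℝ)⁻¹ ^ n - G (n : ℝ)⁻¹ ^ n) atTop (𝓝 0) := by
  have hinv : Tendsto (fun n : ℕ => (n : ℝ)⁻¹) atTop (𝓝 0) := tendsto_inv_atTop_nhds_zero_nat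
  have hbd : ∀ {H : ℝ → 𝔸}, HasDerivAt H D 0 → H 0 = 1 →
      ∀ᶠ n : ℕ in atTop, ‖H (n : ℝ)⁻¹‖ ≤ Real.exp ((‖D‖ + 1) * (n : ℝ)⁻¹) := by
    intro H hH hH0
    have h := hinv.eventually ((hasDerivAt_iff_isLittleO.1 hH).def one_pos)
    filter_upwards [h] with n hn
    simp only [hH0, sub_zero, one_mul, Real.norm_eq_abs, abs_inv, Nat.abs_cast] at hn
    have e : H (n : ℝ)⁻¹ = 1 + (n : ℝ)⁻¹ • D + (H (n : ℝ)⁻¹ - 1 - (n : ℝ)⁻¹ • D) := by abel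
    have h1 : ‖(1 : 𝔸) + (n : ℝ)⁻¹ • D‖ ≤ 1 + (n : ℝ)⁻¹ * ‖D‖ := by
      refine (norm_add_le _ _).trans ?_
      rw [norm_one, norm_smul, Real.norm_eq_abs, abs_of_nonneg (inv_nonneg.2 n.cast_nonneg)]
    rw [e]
    refine (norm_add_le _ _).trans ((add_le_add h1 hn).trans ?_)
    have := Real.add_one_le_exp ((‖D‖ + 1) * (n : ℝ)⁻¹)
    linarith
  have hFG : (fun t => F t - G t) =o[𝓝 0] fun t : ℝ => t := by
    have := (hasDerivAt_iff_isLittleO.1 (hF.sub hG))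
    simpa [hF0, hG0] using this
  rw [NormedAddGroup.tendsto_nhds_zero]
  intro ε hε
  have hc : 0 < ε / 2 / Real.exp (‖D‖ + 1) := by positivity
  filter_upwards [hbd hF hF0, hbd hG hG0, hinv.eventually (hFG.def hc), eventually_gt_atTop 0]
    with n h1 h2 h3 hn
  have hn' : (0 : ℝ) < n := Nat.cast_pos.2 hn
  have hK : 1 ≤ Real.exp ((‖D‖ + 1) * (n : ℝ)⁻¹) := Real.one_le_exp (by positivity)
  have h4 := norm_pow_sub_pow_le_of_norm_le hK h1 h2 n
  rw [← Real.exp_nat_mul, show (n : ℝ) * ((‖D‖ + 1) * (n : ℝ)⁻¹) = ‖D‖ + 1 by field_simp] at h4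
  rw [Real.norm_eq_abs, abs_of_nonneg (inv_nonneg.2 n.cast_nonneg)] at h3
  calc _ ≤ _ := h4
    _ ≤ n * (ε / 2 / Real.exp (‖D‖ + 1) * (n : ℝ)⁻¹) * Real.exp (‖D‖ + 1) := by gcongr
    _ = ε / 2 := by field_simp
    _ < ε := half_lt_self hε

/-- The **Lie–Trotter product formula**. -/
lemma tendsto_exp_mul_exp_pow [NormOneClass 𝔸] [NormedAlgebra ℝ 𝔸] [CompleteSpace 𝔸] (A B : 𝔸) :
    Tendsto (fun n : ℕ => (exp ((n : ℝ)⁻¹ • A) * exp ((n : ℝ)⁻¹ • B)) ^ n) atTop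
      (𝓝 (exp (A + B))) := by
  have hd : ∀ C : 𝔸, HasDerivAt (fun t : ℝ => exp (t • C)) C 0 := by
    intro C
    simpa using hasDerivAt_exp_smul_const (𝕂 := ℝ) C 0
  have hF : HasDerivAt (fun t : ℝ => exp (t • A) * exp (t • B)) (A + B) 0 := by
    simpa using! (hd A).mul (hd B)
  have h := tendsto_pow_sub_pow_of_hasDerivAt hF (hd (A + B)) (by simp) (by simp)
  have h2 := h.add_const (exp (A + B))
  rw [zero_add] at h2
  refine h2.congr' ?_
  filter_upwards [eventually_gt_atTop 0] with n hn
  have : NormedAlgebra ℚ 𝔸 := NormedAlgebra.restrictScalars ℚ ℝ 𝔸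
  rw [← exp_nsmul, ← Nat.cast_smul_eq_nsmul ℝ, smul_smul,
    mul_inv_cancel₀ (Nat.cast_ne_zero.2 hn.ne'), one_smul, sub_add_cancel]

end LieTrotter

namespace Matrix

variable {k : Type*} [Fintype k] [DecidableEq k]

open scoped ComplexOrder MatrixOrder in
lemma PosSemidef.trace_mul_nonneg {P Q : Matrix k k ℂ} (hP : P.PosSemidef) (hQ : Q.PosSemidef) :
    0 ≤ (P * Q).trace := by
  obtain ⟨C, rfl⟩ := CStarAlgebra.nonneg_iff_eq_star_mul_self.1 hP.nonneg
  rw [star_eq_conjTranspose, mul_assoc, trace_mul_comm]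
  exact (hQ.mul_mul_conjTranspose_same C).trace_nonneg

open NormedSpace in
open scoped ComplexOrder in
lemma posSemidef_exp {A : Matrix k k ℂ} (hA : A.IsHermitian) :
    (exp A).PosSemidef := by
  have h : (exp ((2 : ℝ)⁻¹ • A)).IsHermitian := IsHermitian.exp (by
    rw [IsHermitian, conjTranspose_smul, hA.eq, star_trivial])
  have e : exp A = (exp ((2 : ℝ)⁻¹ • A))ᴴ * exp ((2 : ℝ)⁻¹ • A) := by
    rw [h.eq, ← Matrix.exp_add_of_commute _ _ (Commute.refl _), ← two_smul ℝ, smul_smul,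
      mul_inv_cancel₀ two_ne_zero, one_smul]
  rw [e]
  exact posSemidef_conjTranspose_mul_self _

open Filter Topology NormedSpace in
open scoped ComplexOrder in
/-- The **Golden–Thompson inequality**. -/
theorem re_trace_exp_add_le {A B : Matrix k k ℂ} (hA : A.IsHermitian) (hB : B.IsHermitian) :
    (exp (A + B)).trace.re ≤ (exp A * exp B).trace.re := by
  rcases isEmpty_or_nonempty k with hk | hk
  · simp [trace]
  have hherm : ∀ (n : ℕ) {C : Matrix k k ℂ}, C.IsHermitian → (exp ((n : ℝ)⁻¹ • C)).IsHermitian :=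
    fun n C hC => IsHermitian.exp (by
      rw [IsHermitian, conjTranspose_smul, hC.eq, star_trivial])
  have hpow : ∀ (n : ℕ), n ≠ 0 → ∀ C : Matrix k k ℂ, exp ((n : ℝ)⁻¹ • C) ^ n = exp C := by
    intro n hn C
    rw [← Matrix.exp_nsmul, ← Nat.cast_smul_eq_nsmul ℝ, smul_smul,
      mul_inv_cancel₀ (Nat.cast_ne_zero.2 hn), one_smul]
  have hlim := (tendsto_exp_mul_exp_pow A B).comp
    (tendsto_pow_atTop_atTop_of_one_lt (one_lt_two : (1 : ℕ) < 2))
  have hlim2 := ((Complex.continuous_re.comp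
    (continuous_id.matrix_trace : Continuous fun M : Matrix k k ℂ => M.trace)).tendsto _).comp hlim
  have hnn : (0 : ℂ) ≤ (exp A * exp B).trace :=
    (posSemidef_exp hA).trace_mul_nonneg (posSemidef_exp hB)
  refine le_of_tendsto hlim2 (Eventually.of_forall fun j => ?_)
  have h := (norm_trace_two_pow_le_aux j).2 _ _ (hherm (2 ^ j) hA) (hherm (2 ^ j) hB)
  rw [hpow _ (by positivity), hpow _ (by positivity)] at h
  rw [show ‖(exp A * exp B).trace‖ = (exp A * exp B).trace.re from
    congrArg Complex.re (Complex.norm_of_nonneg' hnn)] at h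
  exact (Complex.re_le_norm _).trans h

end Matrix

/-! ### Spectral estimates for Hermitian matrices -/

namespace Matrix

variable {k : Type*} [Fintype k] [DecidableEq k]

lemma IsHermitian.real_smul {k : Type*} {A : Matrix k k ℂ} (hA : A.IsHermitian) (r : ℝ) :
    (r • A).IsHermitian := by
  rw [IsHermitian, conjTranspose_smul, hA.eq, star_trivial]

/-- The spectral theorem, with the unitary matrix written out. -/
lemma IsHermitian.exists_eq_conj_diagonal {A : Matrix k k ℂ} (hA : A.IsHermitian) :
    ∃ U : Matrix k k ℂ, U ∈ unitary (Matrix k k ℂ) ∧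
      A = U * diagonal (fun i => (hA.eigenvalues i : ℂ)) * Uᴴ := by
  refine ⟨hA.eigenvectorUnitary, hA.eigenvectorUnitary.2, ?_⟩
  conv_lhs => rw [hA.spectral_theorem, Unitary.conjStarAlgAut_apply]
  rfl

lemma exp_unitary_conj_diagonal {U : Matrix k k ℂ} (hU : U ∈ unitary (Matrix k k ℂ)) (v : k → ℂ) :
    NormedSpace.exp (U * diagonal v * Uᴴ) = U * diagonal (fun i => Complex.exp (v i)) * Uᴴ := by
  have h1 : U * Uᴴ = 1 := (Unitary.mem_iff.1 hU).2
  have hinv : U⁻¹ = Uᴴ := inv_eq_right_inv h1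
  have hunit : IsUnit U := (Unitary.toUnits ⟨U, hU⟩).isUnit
  rw [← hinv, Matrix.exp_conj _ _ hunit, Matrix.exp_diagonal, Complex.exp_eq_exp_ℂ]
  congr 3
  ext i
  rw [Pi.coe_exp]

lemma trace_unitary_conj {U : Matrix k k ℂ} (hU : U ∈ unitary (Matrix k k ℂ)) (D : Matrix k k ℂ) :
    (U * D * Uᴴ).trace = D.trace := by
  have h1 : Uᴴ * U = 1 := (Unitary.mem_iff.1 hU).1
  rw [trace_mul_comm, ← mul_assoc, h1, one_mul]

lemma IsHermitian.re_trace_exp_smul {A : Matrix k k ℂ} (hA : A.IsHermitian) (r : ℝ) :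
    (NormedSpace.exp (r • A)).trace.re = ∑ i, Real.exp (r * hA.eigenvalues i) := by
  obtain ⟨U, hU, h⟩ := hA.exists_eq_conj_diagonal
  have e : r • A = U * diagonal (fun i => ((r * hA.eigenvalues i : ℝ) : ℂ)) * Uᴴ := by
    conv_lhs => rw [h]
    rw [← smul_mul_assoc, ← mul_smul_comm, ← diagonal_smul]
    congr 3
    ext i
    simp
  rw [e, exp_unitary_conj_diagonal hU, trace_unitary_conj hU]
  simp only [trace_diagonal, Complex.re_sum, ← Complex.ofReal_exp, Complex.ofReal_re]

lemma IsHermitian.norm_eq_norm_eigenvalues {A : Matrix k k ℂ} (hA : A.IsHermitian) :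
    ‖A‖ = ‖hA.eigenvalues‖ := by
  obtain ⟨U, hU, h⟩ := hA.exists_eq_conj_diagonal
  conv_lhs => rw [h]
  have e1 := CStarRing.norm_mul_mem_unitary (U * diagonal (fun i => (hA.eigenvalues i : ℂ)))
    (Unitary.star_mem hU)
  have e2 := CStarRing.norm_mem_unitary_mul (diagonal (fun i => (hA.eigenvalues i : ℂ))) hU
  rw [← star_eq_conjTranspose, e1, e2, l2_opNorm_diagonal]
  simp only [Pi.norm_def, Complex.nnnorm_real]

lemma IsHermitian.exists_abs_eigenvalues_eq [Nonempty k] {A : Matrix k k ℂ} (hA : A.IsHermitian) :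
    ∃ i, |hA.eigenvalues i| = ‖A‖ := by
  obtain ⟨i, hi⟩ := Finite.exists_max fun i => ‖hA.eigenvalues i‖
  refine ⟨i, le_antisymm ?_ ?_⟩
  · rw [hA.norm_eq_norm_eigenvalues]
    exact norm_le_pi_norm hA.eigenvalues i
  · rw [hA.norm_eq_norm_eigenvalues]
    exact (pi_norm_le_iff_of_nonneg (norm_nonneg _)).2 hi

/-- Since `cosh` is even, a large norm forces a large trace of `cosh`, whatever the sign of the
extreme eigenvalue. -/
lemma IsHermitian.cosh_norm_sub_one_le [Nonempty k] {A : Matrix k k ℂ} (hA : A.IsHermitian)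
    (r : ℝ) :
    Real.cosh (r * ‖A‖) - 1 ≤ ((NormedSpace.exp (r • A)).trace.re +
      (NormedSpace.exp ((-r) • A)).trace.re) / 2 - Fintype.card k := by
  obtain ⟨i, hi⟩ := hA.exists_abs_eigenvalues_eq
  have e : ((NormedSpace.exp (r • A)).trace.re + (NormedSpace.exp ((-r) • A)).trace.re) / 2
      - Fintype.card k = ∑ j, (Real.cosh (r * hA.eigenvalues j) - 1) := by
    rw [hA.re_trace_exp_smul, hA.re_trace_exp_smul, ← Finset.sum_add_distrib, Finset.sum_div,
      Finset.sum_sub_distrib]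
    simp [Real.cosh_eq]
  have e2 : Real.cosh (r * ‖A‖) = Real.cosh (r * hA.eigenvalues i) := by
    rw [← hi, ← Real.cosh_abs (r * hA.eigenvalues i), ← Real.cosh_abs, abs_mul, abs_abs, abs_mul]
  rw [e, e2]
  exact Finset.single_le_sum (f := fun j => Real.cosh (r * hA.eigenvalues j) - 1)
    (fun j _ => sub_nonneg.2 (Real.one_le_cosh _)) (Finset.mem_univ i)

open scoped ComplexOrder in
/-- The intrinsic-dimension bound: by convexity `exp` lies below its chord on `[0, κ v]`, so the
trace of `exp (κ V) - 1` is controlled by the trace of `V` and not by the size of the matrix. -/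
lemma PosSemidef.re_trace_exp_smul_sub_card_le {V : Matrix k k ℂ} (hV : V.PosSemidef) {v κ : ℝ}
    (hv : 0 < v) (hVv : (v • (1 : Matrix k k ℂ) - V).PosSemidef) :
    (NormedSpace.exp (κ • V)).trace.re - Fintype.card k ≤
      V.trace.re / v * (Real.exp (κ * v) - 1) := by
  have hle : ∀ i, hV.1.eigenvalues i ≤ v := by
    intro i
    have h := hVv.re_dotProduct_nonneg (hV.1.eigenvectorBasis i)
    have h1 : star (hV.1.eigenvectorBasis i : k → ℂ) ⬝ᵥ (hV.1.eigenvectorBasis i : k → ℂ) = 1 := by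
      have := hV.1.eigenvectorBasis.inner_eq_one i
      rw [EuclideanSpace.inner_eq_star_dotProduct] at this
      rw [dotProduct_comm]; exact this
    rw [sub_mulVec, smul_mulVec, one_mulVec, dotProduct_sub, dotProduct_smul, h1, map_sub,
      ← hV.1.eigenvalues_eq] at h
    simpa using h
  have htr : V.trace.re = ∑ i, hV.1.eigenvalues i := by
    rw [hV.1.trace_eq_sum_eigenvalues]; simp
  rw [hV.1.re_trace_exp_smul, htr, Finset.sum_div, Finset.sum_mul]
  have : (Fintype.card k : ℝ) = ∑ _i : k, (1 : ℝ) := by simp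
  rw [this, ← Finset.sum_sub_distrib]
  refine Finset.sum_le_sum fun i _ => ?_
  have h0 := hV.eigenvalues_nonneg i
  have hw : hV.1.eigenvalues i / v ≤ 1 := (div_le_one hv).2 (hle i)
  have hc := convexOn_exp.2 (Set.mem_univ (κ * v)) (Set.mem_univ 0)
    (div_nonneg h0 hv.le) (sub_nonneg.2 hw) (by ring)
  simp only [smul_eq_mul, mul_zero, add_zero, Real.exp_zero, mul_one] at hc
  rw [show hV.1.eigenvalues i / v * (κ * v) = κ * hV.1.eigenvalues i by field_simp] at hc
  linarith

end Matrix

/-! ### The matrix moment generating function of a centred Bernoulli variable -/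

/-- Bernstein's bound for the exponential function, from the comparison of its Taylor series with
a geometric series of ratio `b / 3`. -/
lemma Real.exp_le_one_add_add_sq_div {x b : ℝ} (hx : |x| ≤ b) (hb : b < 3) :
    Real.exp x ≤ 1 + x + x ^ 2 / (2 * (1 - b / 3)) := by
  have hb0 : 0 ≤ b := (abs_nonneg x).trans hx
  have h1 : HasSum (fun n : ℕ => x ^ (n + 2) / (n + 2).factorial) (Real.exp x - (1 + x)) := by
    have h := NormedSpace.expSeries_div_hasSum_exp x
    rw [← Real.exp_eq_exp_ℝ] at h
    have := (hasSum_nat_add_iff' 2).2 h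
    simpa [Finset.sum_range_succ] using this
  have h2 := (hasSum_geometric_of_lt_one (by positivity : 0 ≤ b / 3) (by linarith)).mul_left
    (x ^ 2 / 2)
  have h := hasSum_le (fun n => ?_) h1 h2
  · rw [mul_comm 2, ← div_div, div_right_comm, div_eq_mul_inv (x ^ 2 / 2)]
    linarith
  · have hf : (2 * 3 ^ n : ℝ) ≤ (n + 2).factorial := by
      have := Nat.factorial_mul_pow_le_factorial (m := 2) (n := n)
      rw [add_comm n 2]
      exact_mod_cast this
    have hxn : x ^ n ≤ b ^ n :=
      (le_abs_self _).trans ((abs_pow x n).le.trans (pow_le_pow_left₀ (abs_nonneg _) hx n))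
    calc x ^ (n + 2) / (n + 2).factorial ≤ x ^ 2 * b ^ n / (n + 2).factorial := by
          rw [pow_add, mul_comm]; gcongr
      _ ≤ x ^ 2 * b ^ n / (2 * 3 ^ n) := by gcongr
      _ = x ^ 2 / 2 * (b / 3) ^ n := by rw [div_pow]; field_simp

lemma bernoulli_mgf_le {q u b : ℝ} (hq0 : 0 ≤ q) (hq1 : q ≤ 1) (hu : |u| ≤ b) (hb : b < 3) :
    q * Real.exp ((1 - q) * u) + (1 - q) * Real.exp (-q * u) ≤
      Real.exp (q * (1 - q) * u ^ 2 / (2 * (1 - b / 3))) := by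
  have h0 : 0 ≤ 1 - q := sub_nonneg.2 hq1
  have h1 : |(1 - q) * u| ≤ b := by
    rw [abs_mul, abs_of_nonneg h0]
    exact (mul_le_of_le_one_left (abs_nonneg _) (by linarith)).trans hu
  have h2 : |-q * u| ≤ b := by
    rw [abs_mul, abs_neg, abs_of_nonneg hq0]
    exact (mul_le_of_le_one_left (abs_nonneg _) hq1).trans hu
  have e1 := mul_le_mul_of_nonneg_left (Real.exp_le_one_add_add_sq_div h1 hb) hq0
  have e2 := mul_le_mul_of_nonneg_left (Real.exp_le_one_add_add_sq_div h2 hb) h0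
  have e3 := Real.add_one_le_exp (q * (1 - q) * u ^ 2 / (2 * (1 - b / 3)))
  refine (add_le_add e1 e2).trans (le_trans (le_of_eq ?_) e3)
  ring

namespace Matrix

variable {k : Type*} [Fintype k] [DecidableEq k]

/-- One step of the induction over the lines. Put `Λ = κ q (1 - q) M²`. The Golden–Thompson
inequality for `(H + Λ) + (X - Λ)`, averaged over the two values of the centred variable `X`,
leaves `tr (exp (H + Λ) * E exp (X - Λ))`. As `X` and `Λ` are functions of the one matrix `M`, the
scalar bound gives `E exp (X - Λ) ≤ 1`. -/
lemma bernoulli_trace_exp_le {H M : Matrix k k ℂ} (hH : H.IsHermitian) (hM : M.IsHermitian)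
    (hM2 : ‖M‖ ≤ 2) {q θ : ℝ} (hq0 : 0 ≤ q) (hq1 : q ≤ 1) (hθ : |θ| < 3 / 2) :
    q * (NormedSpace.exp (H + (θ * (1 - q)) • M)).trace.re +
      (1 - q) * (NormedSpace.exp (H + (θ * (0 - q)) • M)).trace.re ≤
    (NormedSpace.exp (H + (θ ^ 2 / (2 * (1 - 2 * |θ| / 3)) * (q * (1 - q))) • M ^ 2)).trace.re := by
  set c : ℝ := θ ^ 2 / (2 * (1 - 2 * |θ| / 3)) * (q * (1 - q)) with hc
  have hΛ : (c • M ^ 2).IsHermitian := (hM.pow 2).real_smul c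
  have hB := hH.add hΛ
  have hGT : ∀ a : ℝ, (NormedSpace.exp (H + a • M)).trace.re ≤
      (NormedSpace.exp (H + c • M ^ 2) * NormedSpace.exp (a • M - c • M ^ 2)).trace.re := by
    intro a
    have h := re_trace_exp_add_le hB ((hM.real_smul a).sub hΛ)
    rwa [show H + c • M ^ 2 + (a • M - c • M ^ 2) = H + a • M by abel] at h
  obtain ⟨U, hU, hUM⟩ := hM.exists_eq_conj_diagonal
  have hUU : Uᴴ * U = 1 := (Unitary.mem_iff.1 hU).1
  have hUU' : U * Uᴴ = 1 := (Unitary.mem_iff.1 hU).2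
  set d : k → ℝ := hM.eigenvalues with hd
  have hd2 : ∀ i, |d i| ≤ 2 := fun i =>
    (norm_le_pi_norm d i).trans (hM.norm_eq_norm_eigenvalues ▸ hM2)
  have hexp : ∀ a : ℝ, NormedSpace.exp (a • M - c • M ^ 2) =
      U * diagonal (fun i => ((Real.exp (a * d i - c * d i ^ 2) : ℝ) : ℂ)) * Uᴴ := by
    intro a
    have e1 : M ^ 2 = U * diagonal (fun i => (d i : ℂ) ^ 2) * Uᴴ := by
      calc M ^ 2 = U * diagonal (fun i => (d i : ℂ)) * (Uᴴ * U) *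
            diagonal (fun i => (d i : ℂ)) * Uᴴ := by
            rw [sq]; conv_lhs => rw [hUM]
            simp only [mul_assoc]
        _ = _ := by
            rw [hUU, mul_one, mul_assoc U, diagonal_mul_diagonal]; simp only [sq]
    have e2 : a • M - c • M ^ 2 =
        U * diagonal (fun i => ((a * d i - c * d i ^ 2 : ℝ) : ℂ)) * Uᴴ := by
      rw [e1]; conv_lhs => rw [hUM]
      rw [← smul_mul_assoc, ← mul_smul_comm, ← diagonal_smul, ← smul_mul_assoc, ← mul_smul_comm,
        ← diagonal_smul, ← sub_mul, ← mul_sub, diagonal_sub]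
      congr 3
      ext i
      simp
    rw [e2, exp_unitary_conj_diagonal hU]
    simp only [Complex.ofReal_exp]
  set w : k → ℝ := fun i => 1 - (q * Real.exp (θ * (1 - q) * d i - c * d i ^ 2) +
    (1 - q) * Real.exp (θ * (0 - q) * d i - c * d i ^ 2)) with hw
  have hw0 : ∀ i, 0 ≤ w i := by
    intro i
    have hu : |θ * d i| ≤ 2 * |θ| := by
      rw [abs_mul, mul_comm]; exact mul_le_mul_of_nonneg_right (hd2 i) (abs_nonneg _)
    have h := bernoulli_mgf_le hq0 hq1 hu (by linarith)
    have e : q * (1 - q) * (θ * d i) ^ 2 / (2 * (1 - 2 * |θ| / 3)) = c * d i ^ 2 := by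
      rw [hc]; ring
    rw [e] at h
    have h' := mul_le_mul_of_nonneg_right h (Real.exp_pos (-(c * d i ^ 2))).le
    rw [← Real.exp_add, add_neg_cancel, Real.exp_zero, add_mul, mul_assoc q, mul_assoc (1 - q),
      ← Real.exp_add, ← Real.exp_add] at h'
    simp only [hw, sub_nonneg]
    refine le_trans (le_of_eq ?_) h'
    congr 3
    all_goals ring
  have hpsd := open scoped ComplexOrder in
    ((PosSemidef.diagonal (d := fun i => (w i : ℂ)) fun i => by
      simpa using hw0 i).mul_mul_conjTranspose_same U)
  have key := Complex.le_def.1 ((posSemidef_exp hB).trace_mul_nonneg hpsd) |>.1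
  have e : U * diagonal (fun i => (w i : ℂ)) * Uᴴ =
      1 - (q • NormedSpace.exp ((θ * (1 - q)) • M - c • M ^ 2) +
        (1 - q) • NormedSpace.exp ((θ * (0 - q)) • M - c • M ^ 2)) := by
    rw [hexp, hexp]
    rw [← smul_mul_assoc, ← mul_smul_comm, ← diagonal_smul, ← smul_mul_assoc, ← mul_smul_comm,
        ← diagonal_smul, ← add_mul, ← mul_add, diagonal_add]
    have e1 : (1 : Matrix k k ℂ) = U * diagonal (fun _ => 1) * Uᴴ := by
      rw [diagonal_one, mul_one, hUU']
    rw [e1, ← sub_mul, ← mul_sub, diagonal_sub]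
    congr 3
    ext i
    simp [hw]
  rw [e, mul_sub, mul_one, mul_add, mul_smul_comm, mul_smul_comm, trace_sub, trace_add, trace_smul,
    trace_smul] at key
  simp only [Complex.zero_re, Complex.sub_re, Complex.add_re, Complex.smul_re, smul_eq_mul] at key
  have g1 := mul_le_mul_of_nonneg_left (hGT (θ * (1 - q))) hq0
  have g2 := mul_le_mul_of_nonneg_left (hGT (θ * (0 - q))) (sub_nonneg.2 hq1)
  linarith

end Matrix

/-! ### Series of centred Bernoulli variables with matrix coefficients -/

section BernoulliSeries

variable {Ω : Type*} [MeasurableSpace Ω] {μ : Measure Ω}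

lemma ae_eq_zero_or_one_of_hasLaw_bernoulli {X : Ω → ℝ} {q : unitInterval}
    (hX : HasLaw X (bernoulliMeasure 1 0 q) μ) : ∀ᵐ ω ∂μ, X ω = 0 ∨ X ω = 1 := by
  have hm : Measurable fun x : ℝ => x = 0 ∨ x = 1 :=
    measurableSet_setOfPred.1 ((measurableSet_singleton 0).union (measurableSet_singleton 1))
  refine (hX.ae_iff hm).2 ?_
  rw [ae_iff, show {a : ℝ | ¬ (a = 0 ∨ a = 1)} = ({0, 1} : Set ℝ)ᶜ by ext; simp]
  exact bernoulliMeasure_apply_of_notMem_of_notMem q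
    (by measurability) (by simp) (by simp)

lemma integral_of_hasLaw_bernoulli {X : Ω → ℝ} {q : unitInterval}
    (hX : HasLaw X (bernoulliMeasure 1 0 q) μ) : ∫ ω, X ω ∂μ = q := by
  rw [hX.integral_eq, integral_bernoulliMeasure]
  simp

variable [IsProbabilityMeasure μ] {ι : Type*} [Fintype ι] {p : ι → unitInterval}
  {ξ : ι → Ω → ℝ}

/-- A continuous function of Bernoulli variables is bounded, since these range in a cube. -/
lemma integrable_comp_bernoulli {E : Type*} [NormedAddCommGroup E] [SecondCountableTopology E]
    (hξ : ∀ l, HasLaw (ξ l) (bernoulliMeasure 1 0 (p l)) μ)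
    {Φ : (ι → ℝ) → E} (hΦ : Continuous Φ) : Integrable (fun ω => Φ fun l => ξ l ω) μ := by
  borelize E
  obtain ⟨C, hC⟩ := (isCompact_univ_pi fun _ : ι =>
    isCompact_Icc (a := (0 : ℝ)) (b := 1)).bddAbove_image hΦ.norm.continuousOn
  have hmeas : AEMeasurable (fun ω l => ξ l ω) μ :=
    aemeasurable_pi_lambda _ fun l => (hξ l).aemeasurable
  refine Integrable.of_bound (hΦ.measurable.comp_aemeasurable hmeas).aestronglyMeasurable C ?_
  filter_upwards [ae_all_iff.2 fun l => ae_eq_zero_or_one_of_hasLaw_bernoulli (hξ l)] with ω hω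
  refine hC ⟨fun l => ξ l ω, fun l _ => ?_, rfl⟩
  rcases hω l with h | h <;> simp [h]

variable {k : Type*} [Fintype k] [DecidableEq k]

lemma continuous_re_trace_exp :
    Continuous fun A : Matrix k k ℂ => (NormedSpace.exp A).trace.re := by
  have : NormedAlgebra ℚ (Matrix k k ℂ) := NormedAlgebra.restrictScalars ℚ ℂ _
  exact Complex.continuous_re.comp (NormedSpace.exp_continuous).matrix_trace

/-- The summands are replaced one at a time by deterministic matrices; conditionally on the other
summands each replacement is an instance of `Matrix.bernoulli_trace_exp_le`. -/
theorem integral_trace_exp_bernoulli_sum_le (hξ : ∀ l, HasLaw (ξ l) (bernoulliMeasure 1 0 (p l)) μ)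
    (hind : iIndepFun ξ μ) {M : ι → Matrix k k ℂ} (hM : ∀ l, (M l).IsHermitian)
    (hM2 : ∀ l, ‖M l‖ ≤ 2) {θ : ℝ} (hθ : |θ| < 3 / 2) (s : Finset ι) (H : Matrix k k ℂ)
    (hH : H.IsHermitian) :
    ∫ ω, (NormedSpace.exp (H + ∑ l ∈ s, (θ * (ξ l ω - p l)) • M l)).trace.re ∂μ ≤
      (NormedSpace.exp (H + ∑ l ∈ s, (θ ^ 2 / (2 * (1 - 2 * |θ| / 3)) *
        ((p l : ℝ) * (1 - p l))) • M l ^ 2)).trace.re := by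
  classical
  induction s using Finset.induction_on generalizing H with
  | empty => simp
  | insert l s hl ih =>
    set c : ι → ℝ := fun l => θ ^ 2 / (2 * (1 - 2 * |θ| / 3)) * ((p l : ℝ) * (1 - p l)) with hc
    let S : (ι → ℝ) → Matrix k k ℂ := fun x => ∑ j ∈ s, (θ * (x j - p j)) • M j
    have hS : Continuous S := by fun_prop
    have hSH : ∀ x, (S x).IsHermitian := fun x =>
      isSelfAdjoint_sum _ fun j _ => (hM j).real_smul _
    let F : ℝ → (ι → ℝ) → ℝ := fun a x =>
      (NormedSpace.exp (H + S x + (θ * (a - p l)) • M l)).trace.re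
    have hF : ∀ a, Continuous (F a) := fun a =>
      continuous_re_trace_exp.comp (by fun_prop)
    have hindF : ∀ a, IndepFun (ξ l) (fun ω => F a fun j => ξ j ω) μ := by
      intro a
      have h := hind.indepFun_finset₀ {l} s (by simpa using hl) fun j => (hξ j).aemeasurable
      have hψ : Continuous fun x : s → ℝ => (NormedSpace.exp
          (H + ∑ j : s, (θ * (x j - p j)) • M j + (θ * (a - p l)) • M l)).trace.re :=
        continuous_re_trace_exp.comp (by fun_prop)
      have h2 := h.comp (measurable_pi_apply (⟨l, by simp⟩ : ({l} : Finset ι))) hψ.measurable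
      have e : (fun ω => F a fun j => ξ j ω) = (fun x : s → ℝ => (NormedSpace.exp
          (H + ∑ j : s, (θ * (x j - p j)) • M j + (θ * (a - p l)) • M l)).trace.re) ∘
            fun ω (j : s) => ξ j ω := by
        ext ω
        simp only [F, S, Function.comp]
        rw [Finset.sum_coe_sort s fun j => (θ * (ξ j ω - p j)) • M j]
      rw [e]
      exact h2
    have hFint : ∀ a, Integrable (fun ω => F a fun j => ξ j ω) μ := fun a =>
      integrable_comp_bernoulli hξ (hF a)
    have hξFint : ∀ a, Integrable (fun ω => ξ l ω * F a fun j => ξ j ω) μ := fun a =>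
      integrable_comp_bernoulli hξ (Φ := fun x => x l * F a x) ((continuous_apply l).mul (hF a))
    have hprod : ∀ a, ∫ ω, ξ l ω * (F a fun j => ξ j ω) ∂μ =
        p l * ∫ ω, (F a fun j => ξ j ω) ∂μ := by
      intro a
      rw [(hindF a).integral_fun_mul_eq_mul_integral (hξ l).aemeasurable.aestronglyMeasurable
        (hFint a).aestronglyMeasurable, integral_of_hasLaw_bernoulli (hξ l)]
    have hsplit : ∫ ω, (NormedSpace.exp
        (H + ∑ j ∈ insert l s, (θ * (ξ j ω - p j)) • M j)).trace.re ∂μ =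
        ∫ ω, (p l * (F 1 fun j => ξ j ω) + (1 - p l) * (F 0 fun j => ξ j ω)) ∂μ := by
      have h1 : ∫ ω, (NormedSpace.exp
          (H + ∑ j ∈ insert l s, (θ * (ξ j ω - p j)) • M j)).trace.re ∂μ =
          ∫ ω, (ξ l ω * (F 1 fun j => ξ j ω) +
            ((F 0 fun j => ξ j ω) - ξ l ω * (F 0 fun j => ξ j ω))) ∂μ := by
        refine integral_congr_ae ?_
        filter_upwards [ae_eq_zero_or_one_of_hasLaw_bernoulli (hξ l)] with ω hω
        have e : H + ∑ j ∈ insert l s, (θ * (ξ j ω - p j)) • M j =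
            H + S (fun j => ξ j ω) + (θ * (ξ l ω - p l)) • M l := by
          rw [Finset.sum_insert hl]; simp only [S]; abel
        rw [e]
        rcases hω with h | h <;> simp [h, F]
      rw [h1, integral_add (hξFint 1) (show Integrable (fun ω => (F 0 fun j => ξ j ω) -
          ξ l ω * (F 0 fun j => ξ j ω)) μ from (hFint 0).sub (hξFint 0)),
        integral_sub (hFint 0) (hξFint 0), hprod, hprod,
        integral_add ((hFint 1).const_mul _) ((hFint 0).const_mul _), integral_const_mul,
        integral_const_mul]
      ring
    rw [hsplit, Finset.sum_insert hl, ← add_assoc]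
    have hH' : (H + c l • M l ^ 2).IsHermitian := hH.add (((hM l).pow 2).real_smul _)
    refine le_trans (integral_mono (((hFint 1).const_mul _).add ((hFint 0).const_mul _)) ?_ ?_)
      (ih _ hH')
    · exact integrable_comp_bernoulli hξ
        (Φ := fun x => (NormedSpace.exp (H + c l • M l ^ 2 + S x)).trace.re)
        (continuous_re_trace_exp.comp (by fun_prop))
    · intro ω
      have h := Matrix.bernoulli_trace_exp_le (hH.add (hSH fun j => ξ j ω)) (hM l) (hM2 l)
        (p l).2.1 (p l).2.2 hθ
      rw [add_right_comm H _ (_ • M l ^ 2)] at h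
      exact h

end BernoulliSeries

section BernoulliSeries

variable {Ω : Type*} [MeasurableSpace Ω] {μ : Measure Ω} [IsProbabilityMeasure μ]

open scoped ComplexOrder in
/-- The matrix Bernstein inequality with intrinsic dimension, at the level of the moment generating
function. -/
theorem integral_cosh_norm_bernoulli_sum_le {ι k : Type*} [Fintype ι] [Fintype k] [DecidableEq k]
    [Nonempty k] {p : ι → unitInterval} {ξ : ι → Ω → ℝ}
    (hξ : ∀ l, HasLaw (ξ l) (bernoulliMeasure 1 0 (p l)) μ) (hind : iIndepFun ξ μ)
    {M : ι → Matrix k k ℂ} (hM : ∀ l, (M l).IsHermitian) (hM2 : ∀ l, ‖M l‖ ≤ 2) {v θ : ℝ}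
    (hv : 0 < v) (hθ0 : 0 ≤ θ) (hθ : θ < 3 / 2)
    (hV : (v • (1 : Matrix k k ℂ) - ∑ l, ((p l : ℝ) * (1 - p l)) • M l ^ 2).PosSemidef) :
    ∫ ω, (Real.cosh (θ * ‖∑ l, (ξ l ω - p l) • M l‖) - 1) ∂μ ≤
      (∑ l, ((p l : ℝ) * (1 - p l)) • M l ^ 2).trace.re / v *
        (Real.exp (θ ^ 2 / (2 * (1 - 2 * θ / 3)) * v) - 1) := by
  set V := ∑ l, ((p l : ℝ) * (1 - p l)) • M l ^ 2 with hVdef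
  have hVpsd : V.PosSemidef := Matrix.posSemidef_sum _ fun l _ => by
    have h := Matrix.posSemidef_conjTranspose_mul_self (M l)
    rw [(hM l).eq, ← sq] at h
    exact h.smul (mul_nonneg (p l).2.1 (sub_nonneg.2 (p l).2.2))
  let Z : (ι → ℝ) → Matrix k k ℂ := fun x => ∑ l, (x l - p l) • M l
  have hZc : Continuous Z := by fun_prop
  have hZ : ∀ x, (Z x).IsHermitian := fun x => isSelfAdjoint_sum _ fun l _ => (hM l).real_smul _
  have hint : ∀ r : ℝ, Integrable
      (fun ω => (NormedSpace.exp (r • Z fun l => ξ l ω)).trace.re) μ := fun r =>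
    integrable_comp_bernoulli hξ (Φ := fun x => (NormedSpace.exp (r • Z x)).trace.re)
      (continuous_re_trace_exp.comp (by fun_prop))
  have hbound : ∀ r : ℝ, |r| = θ → ∫ ω, (NormedSpace.exp (r • Z fun l => ξ l ω)).trace.re ∂μ ≤
      (NormedSpace.exp ((θ ^ 2 / (2 * (1 - 2 * θ / 3))) • V)).trace.re := by
    intro r hr
    have h := integral_trace_exp_bernoulli_sum_le hξ hind hM hM2 (hr ▸ hθ) Finset.univ 0
      Matrix.isHermitian_zero
    simp only [zero_add, mul_smul, ← Finset.smul_sum] at h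
    rw [hr, ← sq_abs r, hr] at h
    simpa only [hVdef, mul_smul, Z] using h
  have h1 := hbound θ (abs_of_nonneg hθ0)
  have h2 := hbound (-θ) (by rw [abs_neg, abs_of_nonneg hθ0])
  have h3 := hVpsd.re_trace_exp_smul_sub_card_le (κ := θ ^ 2 / (2 * (1 - 2 * θ / 3))) hv hV
  refine le_trans (integral_mono_of_nonneg (ae_of_all _ fun ω => sub_nonneg.2 (Real.one_le_cosh _))
    ((((hint θ).add (hint (-θ))).div_const 2).sub (integrable_const (Fintype.card k : ℝ)))
    (ae_of_all _ fun ω => (hZ fun l => ξ l ω).cosh_norm_sub_one_le θ)) ?_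
  rw [integral_sub' (((hint θ).add (hint (-θ))).div_const 2) (integrable_const _),
    integral_div]
  simp only [Pi.add_apply]
  rw [integral_add (hint θ) (hint (-θ))]
  simp only [integral_const, probReal_univ, one_smul]
  linarith

end BernoulliSeries

/-! ### From the moment generating function to the tail and the mean -/

section Scalar

variable {Ω : Type*} [MeasurableSpace Ω] {μ : Measure Ω} [IsProbabilityMeasure μ] {X : Ω → ℝ}
  {D v : ℝ}

/-- Markov's inequality for `cosh (θ X) - 1`, at the optimal `θ = t / (v + 2 t / 3)`. The lower
bound on `t` ensures `θ t ≥ 1`, which keeps `cosh (θ t) - 1` comparable with `exp (θ t)`. -/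
lemma measureReal_ge_le_of_integral_cosh_le (hv : 0 < v) (hD : 0 ≤ D)
    (hint : ∀ θ : ℝ, Integrable (fun ω => Real.cosh (θ * X ω)) μ)
    (hmgf : ∀ θ : ℝ, 0 ≤ θ → θ < 3 / 2 → ∫ ω, (Real.cosh (θ * X ω) - 1) ∂μ ≤
      D * (Real.exp (θ ^ 2 / (2 * (1 - 2 * θ / 3)) * v) - 1)) {t : ℝ} (ht : √v + 2 / 3 ≤ t) :
    μ.real {ω | t ≤ X ω} ≤ 8 * D * Real.exp (-t ^ 2 / (2 * (v + 2 * t / 3))) := by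
  have hs := Real.sqrt_nonneg v
  have hs2 := Real.sq_sqrt hv.le
  have ht0 : 0 < t := by linarith
  set W := v + 2 * t / 3 with hW
  have hW0 : 0 < W := by positivity
  set θ := t / W with hθ
  have hθ0 : 0 ≤ θ := by positivity
  have hθ1 : θ < 3 / 2 := by rw [hθ, div_lt_iff₀ hW0]; linarith
  set a := t ^ 2 / W with ha
  have haθ : θ * t = a := by rw [hθ, ha]; ring
  have ha1 : 1 ≤ a := by rw [ha, one_le_div hW0]; nlinarith
  have hκ : θ ^ 2 / (2 * (1 - 2 * θ / 3)) * v = a / 2 := by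
    have : 1 - 2 * θ / 3 = v / W := by rw [hθ, hW]; field_simp; ring
    rw [this, hθ, ha]; field_simp
  have hexp : Real.exp a / 8 ≤ Real.cosh a - 1 := by
    have h1 : Real.exp 1 ≤ Real.exp a := Real.exp_le_exp.2 ha1
    have h2 := Real.exp_one_gt_d9
    have h3 := Real.exp_pos (-a)
    rw [Real.cosh_eq]; linarith
  have hsub : {ω | t ≤ X ω} ⊆ {ω | Real.cosh a - 1 ≤ Real.cosh (θ * X ω) - 1} := by
    intro ω hω
    have h : a ≤ θ * X ω := haθ ▸ mul_le_mul_of_nonneg_left hω hθ0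
    have : Real.cosh a ≤ Real.cosh (θ * X ω) := by
      rw [Real.cosh_le_cosh, abs_of_nonneg (by linarith), abs_of_nonneg (by linarith)]
      exact h
    exact sub_le_sub_right this 1
  have hmk := mul_meas_ge_le_integral_of_nonneg
    (ae_of_all μ fun ω => sub_nonneg.2 (Real.one_le_cosh (θ * X ω)))
    ((hint θ).sub (integrable_const 1)) (Real.cosh a - 1)
  have hm := hmgf θ hθ0 hθ1
  rw [hκ] at hm
  have h1 : Real.exp a / 8 * μ.real {ω | t ≤ X ω} ≤ D * Real.exp (a / 2) := by
    calc Real.exp a / 8 * μ.real {ω | t ≤ X ω}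
        ≤ (Real.cosh a - 1) * μ.real {ω | Real.cosh a - 1 ≤ Real.cosh (θ * X ω) - 1} := by
          have := measureReal_mono (μ := μ) hsub
          have := Real.one_le_cosh a
          gcongr
      _ ≤ D * (Real.exp (a / 2) - 1) := hmk.trans hm
      _ ≤ D * Real.exp (a / 2) := by nlinarith
  have e : Real.exp a * Real.exp (-t ^ 2 / (2 * W)) = Real.exp (a / 2) := by
    rw [← Real.exp_add]; congr 1; rw [ha]; field_simp; ring
  have hpos := Real.exp_pos a
  rw [← e] at h1
  refine le_of_mul_le_mul_left (a := Real.exp a / 8) ?_ (by positivity)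
  linarith

/-- The mean is read off from the exponential moment through `x ≤ log K + e ^ x / K - 1`, which
replaces Jensen's inequality. -/
lemma integral_le_of_integral_cosh_le (hv : 0 < v) (hD : 1 ≤ D)
    (hXint : Integrable X μ)
    (hint : ∀ θ : ℝ, Integrable (fun ω => Real.cosh (θ * X ω)) μ)
    (hmgf : ∀ θ : ℝ, 0 ≤ θ → θ < 3 / 2 → ∫ ω, (Real.cosh (θ * X ω) - 1) ∂μ ≤
      D * (Real.exp (θ ^ 2 / (2 * (1 - 2 * θ / 3)) * v) - 1)) :
    ∫ ω, X ω ∂μ ≤ 5 / 2 * (√(v * Real.log (1 + 2 * D)) + 2 * Real.log (1 + 2 * D)) := by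
  set ℓ := Real.log (1 + 2 * D) with hℓ
  have hℓ0 : 0 < ℓ := Real.log_pos (by linarith)
  have key : ∀ θ : ℝ, 0 < θ → θ ≤ 1 → θ * ∫ ω, X ω ∂μ ≤ ℓ + 3 / 2 * θ ^ 2 * v := by
    intro θ hθ0 hθ1
    set κ := θ ^ 2 / (2 * (1 - 2 * θ / 3)) with hκ
    have hκle : κ ≤ 3 / 2 * θ ^ 2 := by
      rw [hκ, div_le_iff₀ (by linarith)]; nlinarith [sq_nonneg θ]
    set K := 2 * D * Real.exp (κ * v) with hK
    have hE := Real.exp_pos (κ * v)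
    have hK0 : 0 < K := by positivity
    have hpt : ∀ ω, θ * X ω ≤ Real.log K - 1 + 2 / K * Real.cosh (θ * X ω) := by
      intro ω
      have h := Real.log_le_sub_one_of_pos (div_pos (Real.exp_pos (θ * X ω)) hK0)
      rw [Real.log_div (Real.exp_pos _).ne' hK0.ne', Real.log_exp] at h
      have h2 : Real.exp (θ * X ω) / K ≤ 2 / K * Real.cosh (θ * X ω) := by
        rw [div_mul_eq_mul_div]
        gcongr
        rw [Real.cosh_eq]
        linarith [Real.exp_pos (-(θ * X ω))]
      linarith
    have h1 : θ * ∫ ω, X ω ∂μ ≤ Real.log K - 1 + 2 / K * ∫ ω, Real.cosh (θ * X ω) ∂μ := by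
      have hc := (hint θ).const_mul (2 / K)
      rw [← integral_const_mul]
      refine (integral_mono (hXint.const_mul θ) ((integrable_const _).add hc) hpt).trans
        (le_of_eq ?_)
      rw [integral_add' (integrable_const _) hc, integral_const_mul]
      simp
    have h2 := hmgf θ hθ0.le (by linarith)
    rw [integral_sub (hint θ) (integrable_const 1)] at h2
    simp only [integral_const, probReal_univ, one_smul] at h2
    have h3 : 2 / K * ∫ ω, Real.cosh (θ * X ω) ∂μ ≤ 1 := by
      rw [div_mul_eq_mul_div, div_le_one hK0, hK]
      nlinarith
    have h4 : Real.log K ≤ ℓ + κ * v := by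
      rw [hK, Real.log_mul (by linarith) hE.ne', Real.log_exp]
      gcongr
      exact Real.log_le_log (by linarith) (by linarith)
    nlinarith
  -- The choice `θ = min 1 √(ℓ / v)` balances the two terms of `key`.
  rcases le_total v ℓ with hvℓ | hvℓ
  · have := key 1 one_pos le_rfl
    have := Real.sqrt_nonneg (v * ℓ)
    linarith
  · have hr0 : 0 < √(v * ℓ) := Real.sqrt_pos.2 (by positivity)
    have hr2 : √(v * ℓ) ^ 2 = v * ℓ := Real.sq_sqrt (by positivity)
    have hrv : √(v * ℓ) ≤ v := by
      rw [Real.sqrt_le_left hv.le]; nlinarith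
    have h := key (√(v * ℓ) / v) (by positivity) ((div_le_one hv).2 hrv)
    rw [div_pow, hr2] at h
    have e : ℓ + 3 / 2 * (v * ℓ / v ^ 2) * v = √(v * ℓ) / v * (5 / 2 * √(v * ℓ)) := by
      have : √(v * ℓ) / v * (5 / 2 * √(v * ℓ)) = 5 / 2 * √(v * ℓ) ^ 2 / v := by ring
      rw [this, hr2]; field_simp; ring
    rw [e] at h
    have := le_of_mul_le_mul_left h (by positivity)
    linarith

end Scalar

/-! ### Hermitian dilation -/

namespace Matrix

/-- The Hermitian dilation of a square matrix `A`: the block matrix with off-diagonal blocks `A`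
and `Aᴴ` and zero diagonal blocks. -/
def dilation {n : Type*} (A : Matrix n n ℂ) : Matrix (n ⊕ n) (n ⊕ n) ℂ := fromBlocks 0 A Aᴴ 0

lemma isHermitian_dilation {n : Type*} (A : Matrix n n ℂ) : (dilation A).IsHermitian := by
  simp [IsHermitian, dilation, fromBlocks_conjTranspose]

lemma dilation_sum_smul {n ι : Type*} (s : Finset ι) (c : ι → ℝ) (A : ι → Matrix n n ℂ) :
    dilation (∑ l ∈ s, c l • A l) = ∑ l ∈ s, c l • dilation (A l) := by
  ext (i | i) (j | j) <;> simp [dilation, sum_apply, conjTranspose_apply]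

variable {n : Type*} [Fintype n] [DecidableEq n]

lemma dilation_sq (A : Matrix n n ℂ) :
    dilation A ^ 2 = fromBlocks (A * Aᴴ) 0 0 (Aᴴ * A) := by
  simp [sq, dilation, fromBlocks_multiply]

lemma norm_le_norm_dilation (A : Matrix n n ℂ) : ‖A‖ ≤ ‖dilation A‖ := by
  rw [l2_opNorm_def A]
  refine ContinuousLinearMap.opNorm_le_bound _ (norm_nonneg _) fun x => ?_
  have h := l2_opNorm_mulVec (dilation A) (WithLp.toLp 2 (Sum.elim 0 x.ofLp))
  have e1 : ‖(WithLp.toLp 2 (Sum.elim 0 x.ofLp) : EuclideanSpace ℂ (n ⊕ n))‖ = ‖x‖ := by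
    simp [EuclideanSpace.norm_eq]
  have e2 : ‖(WithLp.toLp 2 (dilation A *ᵥ Sum.elim 0 x.ofLp) : EuclideanSpace ℂ (n ⊕ n))‖ =
      ‖(WithLp.toLp 2 (A *ᵥ x.ofLp) : EuclideanSpace ℂ n)‖ := by
    simp [EuclideanSpace.norm_eq, dilation, fromBlocks_mulVec]
  rw [e1] at h
  exact e2.symm.le.trans h

open scoped ComplexOrder MatrixOrder in
lemma PosSemidef.fromBlocks_diagonal {A : Matrix n n ℂ} (hA : A.PosSemidef) :
    (fromBlocks A 0 0 A).PosSemidef := by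
  obtain ⟨C, rfl⟩ := CStarAlgebra.nonneg_iff_eq_star_mul_self.1 hA.nonneg
  have : fromBlocks (star C * C) 0 0 (star C * C) =
      (fromBlocks C 0 0 C)ᴴ * fromBlocks C 0 0 C := by
    simp [fromBlocks_conjTranspose, fromBlocks_multiply, star_eq_conjTranspose]
  rw [this]
  exact posSemidef_conjTranspose_mul_self _

end Matrix

/-! ### The random admittance matrix -/

namespace PowerNetwork

open Matrix

variable {n m : ℕ} (N : PowerNetwork n m)

/-- The rank-one matrix `a_l a_lᵀ` of the line `l`. -/
noncomputable def lineMatrix (l : Fin m) : Matrix (Fin n) (Fin n) ℂ :=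
  vecMulVec (N.incidenceVec l) (N.incidenceVec l)

lemma star_incidenceVec (l : Fin m) : star (N.incidenceVec l) = N.incidenceVec l := by
  ext i
  simp only [incidenceVec, Pi.star_apply, Pi.sub_apply, star_sub, Pi.single_apply]
  split_ifs <;> simp

lemma conjTranspose_lineMatrix (l : Fin m) : (N.lineMatrix l)ᴴ = N.lineMatrix l := by
  rw [lineMatrix, conjTranspose_vecMulVec, star_incidenceVec]

lemma incidenceVec_dotProduct_self (l : Fin m) :
    N.incidenceVec l ⬝ᵥ N.incidenceVec l = 2 := by
  have h := N.src_ne_tgt l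
  simp only [incidenceVec, sub_dotProduct, dotProduct_sub, single_one_dotProduct, Pi.single_eq_same,
    Pi.single_eq_of_ne h, Pi.single_eq_of_ne h.symm]
  norm_num

lemma lineMatrix_mul_self (l : Fin m) :
    N.lineMatrix l * N.lineMatrix l = (2 : ℝ) • N.lineMatrix l := by
  rw [lineMatrix, vecMulVec_mul_vecMulVec, incidenceVec_dotProduct_self]
  ext i j
  simp [vecMulVec_apply, mul_left_comm]

lemma dilation_smul_lineMatrix_sq (z : ℂ) (l : Fin m) :
    dilation (z • N.lineMatrix l) ^ 2 =
      (2 * ‖z‖ ^ 2) • fromBlocks (N.lineMatrix l) 0 0 (N.lineMatrix l) := by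
  have e1 : (z • N.lineMatrix l) * (star z • N.lineMatrix l) = (2 * ‖z‖ ^ 2) • N.lineMatrix l := by
    rw [smul_mul_smul_comm, lineMatrix_mul_self]
    ext i j
    simp only [Matrix.smul_apply, smul_eq_mul, Complex.real_smul, Complex.star_def,
      Complex.mul_conj, Complex.normSq_eq_norm_sq]
    push_cast
    ring
  have e2 : (star z • N.lineMatrix l) * (z • N.lineMatrix l) = (2 * ‖z‖ ^ 2) • N.lineMatrix l := by
    rw [← e1, smul_mul_smul_comm, smul_mul_smul_comm, mul_comm]
  rw [dilation_sq, conjTranspose_smul, conjTranspose_lineMatrix, e1, e2, fromBlocks_smul]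
  simp

/-- The dilation `M` of `z a_l a_lᵀ` satisfies `M⁴ = 4 |z|² M²`, and the norm of the square of a
Hermitian matrix is the square of its norm. -/
lemma norm_dilation_smul_lineMatrix_le {z : ℂ} (hz : ‖z‖ ≤ 1) (l : Fin m) :
    ‖dilation (z • N.lineMatrix l)‖ ≤ 2 := by
  set M := dilation (z • N.lineMatrix l) with hM
  have hsq : ∀ A : Matrix (Fin n ⊕ Fin n) (Fin n ⊕ Fin n) ℂ, A.IsHermitian →
      ‖A ^ 2‖ = ‖A‖ ^ 2 := by
    intro A hA
    have h := l2_opNorm_conjTranspose_mul_self A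
    rwa [hA.eq, ← sq, ← sq] at h
  have hMh : M.IsHermitian := isHermitian_dilation _
  have h4 : (M ^ 2) ^ 2 = (4 * ‖z‖ ^ 2) • M ^ 2 := by
    rw [hM, dilation_smul_lineMatrix_sq, sq, smul_mul_smul_comm, fromBlocks_multiply]
    simp only [lineMatrix_mul_self, Matrix.mul_zero, Matrix.zero_mul, add_zero, zero_add,
      fromBlocks_smul, smul_zero, smul_smul]
    congr 2 <;> ring
  have h := hsq _ (hMh.pow 2)
  rw [h4, hsq _ hMh, norm_smul, hsq _ hMh, Real.norm_of_nonneg (by positivity)] at h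
  have hz2 : ‖z‖ ^ 2 ≤ 1 := pow_le_one₀ (norm_nonneg _) hz
  by_contra! hlt
  have h1 : 4 < ‖M‖ ^ 2 := by nlinarith
  nlinarith

section Criticality

variable (y : Fin m → ℂ) (p : Fin m → unitInterval)

lemma contingencyFactor_nonneg (l : Fin m) : 0 ≤ contingencyFactor y p l := by
  have h1 := (p l).2.1
  have h2 := sub_nonneg.2 (p l).2.2
  unfold contingencyFactor
  positivity

lemma criticality_nonneg (i : Fin n) : 0 ≤ N.criticality y p i :=
  Finset.sum_nonneg fun l _ => contingencyFactor_nonneg y p l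

lemma criticality_le_maxCriticality (i : Fin n) : N.criticality y p i ≤ N.maxCriticality y p :=
  le_ciSup (f := fun i => N.criticality y p i) (Set.finite_range _).bddAbove i

lemma maxCriticality_nonneg : 0 ≤ N.maxCriticality y p :=
  Real.iSup_nonneg fun i => N.criticality_nonneg y p i

lemma contingencyFactor_le_maxCriticality (l : Fin m) :
    contingencyFactor y p l ≤ N.maxCriticality y p :=
  (Finset.single_le_sum (f := contingencyFactor y p) (fun l _ => contingencyFactor_nonneg y p l)
    (Finset.mem_filter.2 ⟨Finset.mem_univ l, Or.inl rfl⟩)).trans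
    (N.criticality_le_maxCriticality y p (N.src l))

/-- The endpoints of a line are distinct, so no line is counted twice at a node. -/
lemma criticality_eq_sum (i : Fin n) : N.criticality y p i = ∑ l, contingencyFactor y p l *
    (Pi.single (M := fun _ => ℝ) (N.src l) 1 i + Pi.single (M := fun _ => ℝ) (N.tgt l) 1 i) := by
  rw [criticality, Finset.sum_filter]
  refine Finset.sum_congr rfl fun l _ => ?_
  have h := N.src_ne_tgt l
  simp only [Incident, Pi.single_apply, eq_comm (a := i)]
  by_cases h1 : N.src l = i <;> by_cases h2 : N.tgt l = i <;> simp [h1, h2]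
  exact absurd (h1.trans h2.symm) h

lemma sum_criticality : ∑ i, N.criticality y p i = ∑ l, 2 * contingencyFactor y p l := by
  simp only [criticality_eq_sum]
  rw [Finset.sum_comm]
  refine Finset.sum_congr rfl fun l _ => ?_
  rw [← Finset.mul_sum, Finset.sum_add_distrib]
  simp only [Finset.sum_pi_single', Finset.mem_univ, if_true]
  ring

lemma one_le_normalizedCriticality (h : 0 < N.maxCriticality y p) :
    1 ≤ N.normalizedCriticality y p := by
  rw [normalizedCriticality, inv_mul_eq_div, one_le_div h]
  rcases isEmpty_or_nonempty (Fin n) with hn | hn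
  · rw [maxCriticality, Real.iSup_of_isEmpty] at h; exact absurd h (lt_irrefl _)
  · exact ciSup_le fun i => Finset.single_le_sum (f := fun i => N.criticality y p i)
      (fun i _ => N.criticality_nonneg y p i) (Finset.mem_univ i)

/-- The Laplacian of the network with the contingency factors as line weights. It is the
variance proxy of the random admittance matrix. -/
noncomputable def contingencyLaplacian : Matrix (Fin n) (Fin n) ℂ :=
  ∑ l, contingencyFactor y p l • N.lineMatrix l

lemma re_trace_contingencyLaplacian :
    (N.contingencyLaplacian y p).trace.re = ∑ i, N.criticality y p i := by
  rw [sum_criticality, contingencyLaplacian, trace_sum, Complex.re_sum]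
  refine Finset.sum_congr rfl fun l _ => ?_
  rw [trace_smul, lineMatrix, trace_vecMulVec, incidenceVec_dotProduct_self]
  simp [mul_comm]

open scoped ComplexOrder in
/-- With `b_l = e_i + e_j` one has `a_l a_lᵀ + b_l b_lᵀ = 2 (E_ii + E_jj)`, so twice the diagonal
matrix of degrees dominates the Laplacian. -/
lemma posSemidef_sub_contingencyLaplacian :
    ((2 * N.maxCriticality y p) • (1 : Matrix (Fin n) (Fin n) ℂ) -
      N.contingencyLaplacian y p).PosSemidef := by
  let b : Fin m → Fin n → ℂ := fun l => Pi.single (N.src l) 1 + Pi.single (N.tgt l) 1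
  have hb : ∀ l, star (b l) = b l := by
    intro l
    ext i
    simp only [b, Pi.star_apply, Pi.add_apply, star_add, Pi.single_apply]
    split_ifs <;> simp
  have e : (2 * N.maxCriticality y p) • (1 : Matrix (Fin n) (Fin n) ℂ) -
      N.contingencyLaplacian y p =
      diagonal (fun i => ((2 * (N.maxCriticality y p - N.criticality y p i) : ℝ) : ℂ)) +
        ∑ l, contingencyFactor y p l • vecMulVec (b l) (star (b l)) := by
    have hl : ∀ l, N.lineMatrix l + vecMulVec (b l) (star (b l)) =
        diagonal fun i => 2 * (Pi.single (M := fun _ => ℂ) (N.src l) 1 i +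
          Pi.single (M := fun _ => ℂ) (N.tgt l) 1 i) := by
      intro l
      ext i j
      simp only [hb, lineMatrix, incidenceVec, b, Matrix.add_apply, vecMulVec_apply, Pi.add_apply,
        Pi.sub_apply, diagonal_apply, Pi.single_apply]
      by_cases hij : i = j
      · subst hij
        simp only [if_true]
        split_ifs <;> norm_num
      · have h1 : ¬ (i = N.src l ∧ j = N.src l) := fun h => hij (h.1.trans h.2.symm)
        have h2 : ¬ (i = N.tgt l ∧ j = N.tgt l) := fun h => hij (h.1.trans h.2.symm)
        simp only [hij, if_false]
        split_ifs <;> simp_all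
    have hsum : ∑ l, contingencyFactor y p l • vecMulVec (b l) (star (b l)) =
        (∑ l, contingencyFactor y p l • (diagonal fun i =>
          2 * (Pi.single (M := fun _ => ℂ) (N.src l) 1 i +
          Pi.single (M := fun _ => ℂ) (N.tgt l) 1 i) : Matrix (Fin n) (Fin n) ℂ)) -
        N.contingencyLaplacian y p := by
      rw [contingencyLaplacian, ← Finset.sum_sub_distrib]
      refine Finset.sum_congr rfl fun l _ => ?_
      rw [← smul_sub, ← hl, add_sub_cancel_left]
    have hdiag : (∑ l, contingencyFactor y p l • (diagonal fun i =>
          2 * (Pi.single (M := fun _ => ℂ) (N.src l) 1 i +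
          Pi.single (M := fun _ => ℂ) (N.tgt l) 1 i) : Matrix (Fin n) (Fin n) ℂ)) =
        diagonal fun i => ((2 * N.criticality y p i : ℝ) : ℂ) := by
      ext i j
      simp only [Matrix.sum_apply, Matrix.smul_apply, diagonal_apply]
      split_ifs with hij
      · rw [criticality_eq_sum, Finset.mul_sum, Complex.ofReal_sum]
        refine Finset.sum_congr rfl fun l _ => ?_
        simp only [Pi.single_apply]
        split_ifs <;> simp <;> ring
      · simp
    rw [hsum, hdiag, ← add_sub_assoc, diagonal_add]
    congr 1
    ext i j
    by_cases hij : i = j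
    · subst hij; simp; ring
    · simp [hij]
  rw [e]
  refine (PosSemidef.diagonal fun i => ?_).add (posSemidef_sum _ fun l _ =>
    (posSemidef_vecMulVec_self_star _).smul (contingencyFactor_nonneg y p l))
  have := N.criticality_le_maxCriticality y p i
  simp only [Pi.zero_apply]
  exact_mod_cast (by linarith : 0 ≤ 2 * (N.maxCriticality y p - N.criticality y p i))

lemma sum_variance_smul_dilation_sq :
    ∑ l, ((p l : ℝ) * (1 - p l)) • dilation (y l • N.lineMatrix l) ^ 2 =
      fromBlocks (N.contingencyLaplacian y p) 0 0 (N.contingencyLaplacian y p) := by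
  have h : ∀ l, ((p l : ℝ) * (1 - p l)) • dilation (y l • N.lineMatrix l) ^ 2 =
      contingencyFactor y p l • fromBlocks (N.lineMatrix l) 0 0 (N.lineMatrix l) := by
    intro l
    rw [dilation_smul_lineMatrix_sq, smul_smul, contingencyFactor]
    congr 1
    ring
  simp only [h, contingencyLaplacian]
  ext (i | i) (j | j) <;> simp [Matrix.sum_apply]

end Criticality

section Centred

variable {Ω : Type*} [MeasurableSpace Ω] {μ : Measure Ω} [IsProbabilityMeasure μ]
  {y : Fin m → ℂ} {p : Fin m → unitInterval} {ξ : Fin m → Ω → ℝ}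

lemma centredAdmittance_eq_sum (hξ : ∀ l, HasLaw (ξ l) (bernoulliMeasure 1 0 (p l)) μ) (ω : Ω) :
    N.centredAdmittance μ y ξ ω = ∑ l, (ξ l ω - p l) • (y l • N.lineMatrix l) := by
  ext i j
  have hi : ∀ l, Integrable (ξ l) μ := fun l =>
    integrable_comp_bernoulli hξ (Φ := fun x => x l) (continuous_apply l)
  have e : ∀ ω', N.randomAdmittance y ξ ω' i j =
      ∑ l, (ξ l ω' : ℂ) * (y l * N.lineMatrix l i j) := by
    intro ω'
    simp [randomAdmittance, admittanceMatrix, lineMatrix, Matrix.sum_apply, mul_assoc]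
  simp only [centredAdmittance, Matrix.sub_apply, of_apply, e]
  rw [integral_finsetSum _ fun l _ => (hi l).ofReal.mul_const _, ← Finset.sum_sub_distrib,
    Matrix.sum_apply]
  refine Finset.sum_congr rfl fun l _ => ?_
  rw [integral_mul_const, integral_complex_ofReal, integral_of_hasLaw_bernoulli (hξ l)]
  simp [sub_mul]

lemma dilation_centredAdmittance (hξ : ∀ l, HasLaw (ξ l) (bernoulliMeasure 1 0 (p l)) μ) (ω : Ω) :
    dilation (N.centredAdmittance μ y ξ ω) =
      ∑ l, (ξ l ω - p l) • dilation (y l • N.lineMatrix l) := by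
  rw [N.centredAdmittance_eq_sum hξ, dilation_sum_smul]

lemma integrable_comp_norm_centredAdmittance
    (hξ : ∀ l, HasLaw (ξ l) (bernoulliMeasure 1 0 (p l)) μ) {f : ℝ → ℝ} (hf : Continuous f) :
    Integrable (fun ω => f ‖N.centredAdmittance μ y ξ ω‖) μ := by
  simp only [N.centredAdmittance_eq_sum hξ]
  exact integrable_comp_bernoulli hξ
    (Φ := fun x => f ‖∑ l, (x l - p l) • (y l • N.lineMatrix l)‖) (hf.comp (by fun_prop))

/-- If no line is contingent, every line is almost surely in its expected state, or has zero
admittance. -/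
lemma norm_centredAdmittance_ae_eq_zero (hξ : ∀ l, HasLaw (ξ l) (bernoulliMeasure 1 0 (p l)) μ)
    (h : N.maxCriticality y p = 0) : ∀ᵐ ω ∂μ, ‖N.centredAdmittance μ y ξ ω‖ = 0 := by
  have key : ∀ l, ∀ᵐ ω ∂μ, (ξ l ω - p l) • (y l • N.lineMatrix l) = 0 := by
    intro l
    have h0 : contingencyFactor y p l = 0 := le_antisymm
      (h ▸ N.contingencyFactor_le_maxCriticality y p l) (contingencyFactor_nonneg y p l)
    rw [contingencyFactor] at h0
    have hl := hξ l
    simp only [mul_eq_zero, OfNat.ofNat_ne_zero, false_or, pow_eq_zero_iff, ne_eq,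
      not_false_eq_true, norm_eq_zero] at h0
    rcases h0 with (h0 | h0) | h0
    · have hp : p l = 0 := Subtype.ext h0
      rw [hp, bernoulliMeasure_zero] at hl
      filter_upwards [hl.ae_eq_of_dirac] with ω hω
      simp [hω, hp]
    · have hp : p l = 1 := Subtype.ext (sub_eq_zero.1 h0).symm
      rw [hp, bernoulliMeasure_one] at hl
      filter_upwards [hl.ae_eq_of_dirac] with ω hω
      simp [hω, hp]
    · simp [h0]
  filter_upwards [ae_all_iff.2 key] with ω hω
  rw [N.centredAdmittance_eq_sum hξ, Finset.sum_eq_zero fun l _ => hω l, norm_zero]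

end Centred

end PowerNetwork

/-! ### Concentration of the random admittance matrix -/

namespace PowerNetwork

open Matrix

open scoped ComplexOrder in
/-- With variance proxy `v = 2 Δ_c` the intrinsic dimension of the dilated sum is `2 tr L / v`,
which is the normalized total criticality. -/
lemma integral_cosh_norm_centredAdmittance_le {n m : ℕ} (N : PowerNetwork n m) {Ω : Type*}
    [MeasurableSpace Ω] {μ : Measure Ω} [IsProbabilityMeasure μ] {y : Fin m → ℂ}
    {p : Fin m → unitInterval} {ξ : Fin m → Ω → ℝ} (hy : ∀ l, ‖y l‖ ≤ 1)
    (hξ : ∀ l, HasLaw (ξ l) (bernoulliMeasure 1 0 (p l)) μ) (hind : iIndepFun ξ μ)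
    (hΔ : 0 < N.maxCriticality y p) {θ : ℝ} (hθ0 : 0 ≤ θ) (hθ : θ < 3 / 2) :
    ∫ ω, (Real.cosh (θ * ‖N.centredAdmittance μ y ξ ω‖) - 1) ∂μ ≤
      N.normalizedCriticality y p *
        (Real.exp (θ ^ 2 / (2 * (1 - 2 * θ / 3)) * (2 * N.maxCriticality y p)) - 1) := by
  have hne : Nonempty (Fin n) := by
    by_contra h
    rw [not_nonempty_iff] at h
    rw [maxCriticality, Real.iSup_of_isEmpty] at hΔ
    exact lt_irrefl _ hΔ
  have hV : ((2 * N.maxCriticality y p) • (1 : Matrix (Fin n ⊕ Fin n) (Fin n ⊕ Fin n) ℂ) -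
      ∑ l, ((p l : ℝ) * (1 - p l)) • dilation (y l • N.lineMatrix l) ^ 2).PosSemidef := by
    have h := (N.posSemidef_sub_contingencyLaplacian y p).fromBlocks_diagonal
    rw [sum_variance_smul_dilation_sq, ← fromBlocks_one, fromBlocks_smul, sub_eq_add_neg,
      fromBlocks_neg, fromBlocks_add]
    simpa [sub_eq_add_neg] using h
  have h := integral_cosh_norm_bernoulli_sum_le hξ hind
    (fun l => isHermitian_dilation (y l • N.lineMatrix l))
    (fun l => N.norm_dilation_smul_lineMatrix_le (hy l) l) (mul_pos two_pos hΔ) hθ0 hθ hV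
  have htr : (∑ l, ((p l : ℝ) * (1 - p l)) • dilation (y l • N.lineMatrix l) ^ 2).trace.re /
      (2 * N.maxCriticality y p) = N.normalizedCriticality y p := by
    have htf : ∀ A : Matrix (Fin n) (Fin n) ℂ, (fromBlocks A 0 0 A).trace = A.trace + A.trace := by
      simp [trace, Fintype.sum_sum_type]
    rw [sum_variance_smul_dilation_sq, htf, Complex.add_re, re_trace_contingencyLaplacian,
      normalizedCriticality]
    field_simp
    ring
  rw [htr] at h
  simp only [← N.dilation_centredAdmittance hξ] at h
  refine le_trans (integral_mono_of_nonneg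
    (ae_of_all _ fun ω => sub_nonneg.2 (Real.one_le_cosh _)) ?_ (ae_of_all _ fun ω => ?_)) h
  · simp only [N.dilation_centredAdmittance hξ]
    exact integrable_comp_bernoulli hξ (Φ := fun x => Real.cosh
      (θ * ‖∑ l, (x l - p l) • dilation (y l • N.lineMatrix l)‖) - 1)
      ((Real.continuous_cosh.comp (by fun_prop)).sub continuous_const)
  · have h1 := mul_le_mul_of_nonneg_left
      (norm_le_norm_dilation (N.centredAdmittance μ y ξ ω)) hθ0
    have : Real.cosh (θ * ‖N.centredAdmittance μ y ξ ω‖) ≤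
        Real.cosh (θ * ‖dilation (N.centredAdmittance μ y ξ ω)‖) := by
      rwa [Real.cosh_le_cosh, abs_of_nonneg (by positivity), abs_of_nonneg (by positivity)]
    exact sub_le_sub_right this 1

end PowerNetwork

/-- The norm of a matrix is the operator norm on Euclidean space, and `bernoulliMeasure 1 0 p` is the law
with mass `p` at `1` and `1 - p` at `0`. The constant `C` is universal. -/
theorem mainTheorem1 :
    ∃ C : ℝ, 0 < C ∧
      ∀ (n m : ℕ) (N : PowerNetwork n m) (y : Fin m → ℂ) (p : Fin m → unitInterval)
        (Ω : Type*) [MeasurableSpace Ω] (μ : Measure Ω) [IsProbabilityMeasure μ]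
        (ξ : Fin m → Ω → ℝ),
        (∀ l, ‖y l‖ ≤ 1) →
        (∀ l, HasLaw (ξ l) (bernoulliMeasure 1 0 (p l)) μ) →
        iIndepFun ξ μ →
        (∀ t : ℝ, √(2 * N.maxCriticality y p) + 2 / 3 ≤ t →
          μ.real {ω | t ≤ ‖N.centredAdmittance μ y ξ ω‖} ≤
            8 * N.normalizedCriticality y p *
              Real.exp (-t ^ 2 / (4 * (N.maxCriticality y p + t / 3)))) ∧
        Integrable (fun ω => ‖N.centredAdmittance μ y ξ ω‖) μ ∧
        ∫ ω, ‖N.centredAdmittance μ y ξ ω‖ ∂μ ≤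
          C * (√(2 * N.maxCriticality y p * Real.log (1 + 2 * N.normalizedCriticality y p)) +
            2 * Real.log (1 + 2 * N.normalizedCriticality y p)) := by
  refine ⟨5 / 2, by norm_num, fun n m N y p Ω _ μ _ ξ hy hξ hind => ?_⟩
  have hint : Integrable (fun ω => ‖N.centredAdmittance μ y ξ ω‖) μ :=
    N.integrable_comp_norm_centredAdmittance hξ (f := fun x => x) continuous_id
  have hcosh : ∀ θ : ℝ, Integrable (fun ω => Real.cosh (θ * ‖N.centredAdmittance μ y ξ ω‖)) μ :=
    fun θ => N.integrable_comp_norm_centredAdmittance hξ (f := fun x => Real.cosh (θ * x))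
      (Real.continuous_cosh.comp (continuous_const.mul continuous_id))
  rcases (N.maxCriticality_nonneg y p).eq_or_lt with h0 | hΔ
  -- Here the normalized criticality is `0⁻¹ * _ = 0`, so both bounds assert that a null random
  -- variable vanishes.
  · have hae := N.norm_centredAdmittance_ae_eq_zero hξ h0.symm
    refine ⟨fun t ht => ?_, hint, ?_⟩
    · have ht0 : 0 < t := by
        have := Real.sqrt_nonneg (2 * N.maxCriticality y p)
        linarith
      have hz : μ.real {ω | t ≤ ‖N.centredAdmittance μ y ξ ω‖} = 0 := by
        rw [measureReal_eq_zero_iff]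
        refine measure_mono_null (fun ω (hω : t ≤ _) => ?_) (ae_iff.1 hae)
        exact (ht0.trans_le hω).ne'
      rw [hz, PowerNetwork.normalizedCriticality, ← h0]
      simp
    · rw [integral_congr_ae hae, PowerNetwork.normalizedCriticality, ← h0]
      simp
  · have hmgf := fun (θ : ℝ) (hθ0 : 0 ≤ θ) (hθ : θ < 3 / 2) =>
      N.integral_cosh_norm_centredAdmittance_le hy hξ hind hΔ hθ0 hθ
    have hD := N.one_le_normalizedCriticality y p hΔ
    refine ⟨fun t ht => ?_, hint, ?_⟩
    · have h := measureReal_ge_le_of_integral_cosh_le (by linarith) (by linarith) hcosh hmgf ht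
      rwa [show 2 * (2 * N.maxCriticality y p + 2 * t / 3) =
        4 * (N.maxCriticality y p + t / 3) by ring] at h
    · exact integral_le_of_integral_cosh_le (by linarith) hD hint hcosh hmgf
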